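/- Let $d,m\ge 1$ be integers and $\mathcal X=[0,1]^d$. For bounded measurable $f:\mathcal X\to\mathbb R$ let $Z_f=\int_{\mathcal X}e^{f(x)}\,dx$ and let $P_f$ be the probability distribution on $\mathcal X$ with density $e^{f}/Z_f$. For $B>0$ let $\mathcal F_{d,m,B}$ be the set of all $f\in C^m(\mathcal X)$ with $\|\partial_\alpha f\|_\infty\le B$ for all multi-indices $\alpha$ with $|\alpha|_1\le m$. For probability distributions $P,Q$ on $\mathcal X$ let $D_{\text{sup-log}}(P,Q)=\|\log(dP/dQ)\|_\infty$, and $D_{\text{sup-log}}(P,Q)=\infty$ unless $P\ll Q$ and $Q\ll P$. A sampling algorithm with $n$ adaptive stochastic evaluation points has a source of randomness $\omega\sim P_\Omega$ that does not depend on $f$. It successively evaluates $f$ at points $x_1,\dots,x_n\in\mathcal X$, where $x_k$ is a function of $\omega$ and of $f(x_1),\dots,f(x_{k-1})$, and it outputs a random point $X_f\in\mathcal X$ that is a function of $\omega$ and of $f(x_1),\dots,f(x_n)$. Let $\mathcal A_n$ be the set of all maps $\tilde S$ on $\mathcal F_{d,m,B}$ that arise from such an algorithm by letting $\tilde S(f)$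 be the distribution of $X_f$, and let $$e_n(\mathcal F_{d,m,B})=\inf_{\tilde S\in\mathcal A_n}\ \sup_{f\in\mathcal F_{d,m,B}}D_{\text{sup-log}}(P_f,\tilde S(f)).$$ Then there are constants $C,K>0$ that depend only on $m$ and $d$ such that for all $B>0$ and all integers $n\ge1$ $$e_n(\mathcal F_{d,m,B})\le\begin{cases}K\,Bn^{-m/d}&\text{if } C\,Bn^{-m/d}>1,\\ K\,(C\,Bn^{-m/d})^{n/2+1}&\text{if } C\,Bn^{-m/d}\le1.\end{cases}$$ Moreover, this bound is achieved by a map $\tilde S\in\mathcal A_n$ of the following form. There are $\lfloor n/2\rfloor$ fixed points of $\mathcal X$ and, for every $f\in\mathcal F_{d,m,B}$, a measurable function $g=g_f$ on $\mathcal X$ that depends on $f$ only through its values at these points, with $f\le g\le f+C\,Bn^{-m/d}$ on $\mathcal X$. The distribution $\tilde S(f)$ is the output distribution of rejection sampling with a budget of $k=\lceil n/2\rceil$ steps (in each step draw independent $x\sim P_g$ and $u\sim\mathcal U([0,1])$, and return $x$ if $ue^{g(x)}\le e^{f(x)}$; after $k$ rejections return a sample from $P_g$). It satisfies $$\tilde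 S(f)=(1-p_R)P_f+p_RP_g,\qquad p_R=(1-Z_f/Z_g)^{k},$$ and $D_{\text{sup-log}}(P_f,\tilde S(f))$ is at most the right-hand side of the bound above. -/

import Mathlib

open MeasureTheory Set
open scoped ENNReal

noncomputable section

namespace GibbsSampling

/-- The unit cube `[0,1]^d` as a subset of `ℝ^d`. -/
abbrev cube (d : ℕ) : Set (Fin d → ℝ) := Set.Icc 0 1

/-- The domain `𝒳 = [0,1]^d` as a space. Its `volume` is Lebesgue measure on the cube, which is
the uniform distribution `𝒰(𝒳)`. -/
abbrev Cube (d : ℕ) : Type := cube d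

instance (d : ℕ) : MeasureSpace (Cube d) := Measure.Subtype.measureSpace

/-- A function on the cube, extended by `0` to `ℝ^d`. Only used together with notions relative to
the cube (`ContDiffOn`, `iteratedFDerivWithin`), which do not depend on the values outside. -/
def ext {d : ℕ} (f : Cube d → ℝ) : (Fin d → ℝ) → ℝ := Function.extend Subtype.val f 0

/-- The partial derivative `∂_{i_1} ⋯ ∂_{i_k} f (x)` at a point of the cube (one-sided at the
boundary). For `f ∈ C^k` it only depends on the multi-index counting how often each coordinate
occurs in `i`, and every multi-index `α` with `|α|₁ = k` arises from some `i`. -/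
def partialDeriv {d : ℕ} (k : ℕ) (i : Fin k → Fin d) (f : Cube d → ℝ) (x : Cube d) : ℝ :=
  iteratedFDerivWithin ℝ k (ext f) (cube d) (x : Fin d → ℝ) (fun j => Pi.single (i j) (1 : ℝ))

/-- The class `ℱ_{d,m,B}` of all `f ∈ C^m([0,1]^d)` whose partial derivatives of all orders
`0, …, m` are bounded by `B` in absolute value. As these derivatives are continuous on the cube,
their essential supremum is a supremum over all points. -/
def smoothClass (d m : ℕ) (B : ℝ) : Set (Cube d → ℝ) :=
  {f | ContDiffOn ℝ m (ext f) (cube d) ∧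
    ∀ k ≤ m, ∀ (i : Fin k → Fin d) (x : Cube d), |partialDeriv k i f x| ≤ B}

/-- The partition function `Z_f = ∫ exp (f x) dx`. -/
def partitionFn {d : ℕ} (f : Cube d → ℝ) : ℝ := ∫ x, Real.exp (f x)

/-- The Gibbs distribution `P_f` on the cube with Lebesgue density `exp (f x) / Z_f`. -/
def gibbs {d : ℕ} (f : Cube d → ℝ) : Measure (Cube d) :=
  volume.withDensity (fun x => ENNReal.ofReal (Real.exp (f x) / partitionFn f))

open Classical in
/-- The sup-log distance `‖log (dP/dQ)‖_∞`, which is `∞` unless `P` and `Q` are absolutely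
continuous with respect to each other. The essential supremum is taken with respect to `Q`, for
which `dP/dQ` is determined almost everywhere; if `P` or `Q` is a Gibbs distribution (as it is
below), then in the first case `Q` has the same null sets as Lebesgue measure, so that it is the usual
essential supremum over the cube. -/
def supLogDist {d : ℕ} (P Q : Measure (Cube d)) : ℝ≥0∞ :=
  if P ≪ Q ∧ Q ≪ P then eLpNorm (fun x => Real.log (P.rnDeriv Q x).toReal) ∞ Q else ∞

/-- An idealized sampling algorithm with random source `Ω` and adaptive stochastic evaluation
points: from the `k` function values seen so far and from `ω`, `query k` chooses the next
evaluation point; `output` chooses the sample from the `n` observed function values and `ω`. -/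
structure SamplingAlgorithm (d n : ℕ) (Ω : Type) where
  query : (k : ℕ) → (Fin k → ℝ) → Ω → Cube d
  output : (Fin n → ℝ) → Ω → Cube d

namespace SamplingAlgorithm

variable {d n : ℕ} {Ω : Type}

/-- The first `k` observed function values `N(f, ω)`. -/
def observe (A : SamplingAlgorithm d n Ω) (f : Cube d → ℝ) (ω : Ω) : (k : ℕ) → (Fin k → ℝ)
  | 0 => Fin.elim0
  | k + 1 => Fin.snoc (observe A f ω k) (f (A.query k (observe A f ω k) ω))

/-- The evaluation point chosen after `k` function values have been observed. -/
def evalPoint (A : SamplingAlgorithm d n Ω) (f : Cube d → ℝ) (k : ℕ) (ω : Ω) : Cube d :=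
  A.query k (A.observe f ω k) ω

/-- The sample `X_f(ω)` returned after `n` function evaluations. -/
def sample (A : SamplingAlgorithm d n Ω) (f : Cube d → ℝ) (ω : Ω) : Cube d :=
  A.output (A.observe f ω n) ω

end SamplingAlgorithm

/-- The set of all maps `S̃ : ℱ → {distributions on the cube}` for which there are a probability
space `(Ω, P_Ω)` and a sampling algorithm with `n` adaptive stochastic function evaluations such
that, for every `f ∈ ℱ`, the evaluation points and the sample `X_f` are random variables and
`S̃(f)` is the distribution of `X_f`. -/
def adStochMaps {d : ℕ} (F : Set (Cube d → ℝ)) (n : ℕ) : Set (F → Measure (Cube d)) :=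
  {S | ∃ (Ω : Type) (_ : MeasurableSpace Ω) (P : Measure Ω) (A : SamplingAlgorithm d n Ω),
    IsProbabilityMeasure P ∧
    ∀ f : F, (∀ k < n, Measurable (A.evalPoint f k)) ∧ Measurable (A.sample f) ∧
      S f = P.map (A.sample f)}

/-- The minimax optimal error `inf_{S̃} sup_{f ∈ ℱ} D(S(f), S̃(f))` over all maps `S̃` that are
realized by sampling algorithms with `n` adaptive stochastic function evaluations. -/
def adStochError {d : ℕ} (F : Set (Cube d → ℝ)) (S : (Cube d → ℝ) → Measure (Cube d))
    (D : Measure (Cube d) → Measure (Cube d) → ℝ≥0∞) (n : ℕ) : ℝ≥0∞ :=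
  ⨅ T ∈ adStochMaps F n, ⨆ f : F, D (S f) (T f)

/-- The maps `φ ∘ N` on `ℱ`, with `N(f) = (f(x_1), …, f(x_n))` for deterministic nonadaptive
points `x_1, …, x_n`, whose values are again functions on the cube. -/
def detApproxMaps {d : ℕ} (F : Set (Cube d → ℝ)) (n : ℕ) : Set (F → (Cube d → ℝ)) :=
  {G | ∃ (x : Fin n → Cube d) (φ : (Fin n → ℝ) → (Cube d → ℝ)),
    ∀ f : F, G f = φ (fun i => f.1 (x i))}

open Classical in
/-- The output distribution of rejection sampling for `P_f` with proposal distribution `P_g` and a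
budget of `k` steps: in each step draw `x ∼ P_g` and `u ∼ 𝒰([0,1])` independently and return `x`
if `u e^{g(x)} ≤ e^{f(x)}`; if the budget is used up, return a sample from `P_g`. -/
def rejectionLaw {d : ℕ} (f g : Cube d → ℝ) : ℕ → Measure (Cube d)
  | 0 => gibbs g
  | k + 1 => ((gibbs g).prod (volume : Measure unitInterval)).bind fun p =>
      if (p.2 : ℝ) * Real.exp (g p.1) ≤ Real.exp (f p.1) then Measure.dirac p.1
      else rejectionLaw f g k

/-- The probability `(1 - Z_f / Z_g)^k` that all `k` steps of rejection sampling reject. -/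
def rejectionProb {d : ℕ} (f g : Cube d → ℝ) (k : ℕ) : ℝ :=
  (1 - partitionFn f / partitionFn g) ^ k

/-- The bound `K r` if `C r > 1`, and `K (C r)^{n/2+1}` if `C r ≤ 1`. -/
def twoRegimeBound (C K r : ℝ) (n : ℕ) : ℝ :=
  if 1 < C * r then K * r else K * (C * r) ^ ((n : ℝ) / 2 + 1)

end GibbsSampling

end

/-! Half of the evaluations build an upper approximation `g` of `f`, the other half run rejection
sampling with proposals from `P_g`.

Take `g` to be the supremum of all class members that agree with `f` on a grid. Then `f ≤ g`, and `g
≤ f + δ` as soon as any two members agreeing on the grid differ by at most `δ`. That bound comes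
from one dimension: a function that is small at `2 ^ m` separated points and has bounded `m`-th
derivative is small throughout, by pairing points, applying the mean value theorem and inducting on
`m`. Freeing the coordinates one at a time carries it to the cube (`abs_sub_le_of_eqOn_grid`), with
`δ = C B n^{-m/d}`.

Each rejection step accepts with probability `Z_f / Z_g`, and an accepted point has law `P_f`, so
the output law is the mixture `(1 - p) P_f + p P_g` (`rejectionLaw_eq`). Its density with respect to
`P_f` is `1 - p + p q` with `q = e^{g-f} Z_f / Z_g` in `[e^{-δ}, e^δ]`. Hence its logarithm is at
most `δ` in absolute value. If `δ ≤ 1` it is of order `δ p ≤ δ^{k+1}`, since `1 - Z_f / Z_g ≤ 1 -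
e^{-δ} ≤ δ`.

To make the randomness independent of `f`, proposals from `P_g` are images of uniform variables
(`exists_mem_adStochMaps`). -/

noncomputable section

namespace GibbsSampling

/-! ### One-dimensional estimate from separated points -/

/-- The factor by which errors at `2 ^ m` points of an interval are amplified, when the length of
the interval is `R` times the minimal distance of the points. -/
def samplingFactor (R : ℝ) : ℕ → ℝ
  | 0 => 0
  | m + 1 => 1 + 2 * R * samplingFactor R m

/-- A function with bounded `m`-th derivative on `[a, b]` that is small at `2 ^ m` separated points
is small on the whole interval. The functions `D k` are the successive derivatives of `D 0`. -/
theorem abs_le_of_abs_le_separated (m : ℕ) : ∀ {D : ℕ → ℝ → ℝ} {t : ℕ → ℝ} {a b δ M ε : ℝ},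
    0 < δ →
    (∀ k < m, ∀ s ∈ Icc a b, HasDerivWithinAt (D k) (D (k + 1) s) (Icc a b) s) →
    (∀ s ∈ Icc a b, |D m s| ≤ M) →
    (∀ i < 2 ^ m, t i ∈ Icc a b) →
    (∀ i, i + 1 < 2 ^ m → t i + δ ≤ t (i + 1)) →
    (∀ i < 2 ^ m, |D 0 (t i)| ≤ ε) →
    ∀ s ∈ Icc a b, |D 0 s| ≤ samplingFactor ((b - a) / δ) m * ε + (b - a) ^ m * M := by
  induction m with
  | zero =>
    intro D t a b δ M ε hδ hD hM ht hsep hε s hs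
    simpa [samplingFactor] using hM s hs
  | succ m ih =>
    intro D t a b δ M ε hδ hD hM ht hsep hε s hs
    have hpow : 2 ^ (m + 1) = 2 * 2 ^ m := by ring
    -- Disjoint pairs `(2i, 2i+1)` leave a gap of `δ` between consecutive pairs, so the mean value
    -- points `ξ i` are again `δ`-separated and the induction hypothesis applies to the derivative.
    have key : ∀ i, ∃ ξ, i < 2 ^ m → t (2 * i) ≤ ξ ∧ ξ ≤ t (2 * i + 1) ∧
        |D 1 ξ| ≤ 2 * ε / δ := by
      intro i
      by_cases hi : i < 2 ^ m
      swap
      · exact ⟨0, fun h => absurd h hi⟩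
      have h1 := ht (2 * i) (by omega)
      have h2 := ht (2 * i + 1) (by omega)
      have h12 := hsep (2 * i) (by omega)
      have hsub : Icc (t (2 * i)) (t (2 * i + 1)) ⊆ Icc a b := Icc_subset_Icc h1.1 h2.2
      obtain ⟨c, hc, hc'⟩ := exists_hasDerivAt_eq_slope (D 0) (D 1)
        (show t (2 * i) < t (2 * i + 1) by linarith)
        (fun x hx => ((hD 0 (by omega) x (hsub hx)).continuousWithinAt).mono hsub)
        (fun x hx => (hD 0 (by omega) x (hsub (Ioo_subset_Icc_self hx))).hasDerivAt
          (Filter.mem_of_superset (Icc_mem_nhds hx.1 hx.2) hsub))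
      refine ⟨c, fun _ => ⟨hc.1.le, hc.2.le, ?_⟩⟩
      have e1 := hε (2 * i) (by omega)
      have e2 := hε (2 * i + 1) (by omega)
      have e0 : 0 ≤ ε := (abs_nonneg _).trans e1
      rw [hc', abs_div]
      refine div_le_div₀ (by positivity) ?_ hδ ?_
      · exact (abs_sub _ _).trans (by linarith)
      · rw [abs_of_pos (by linarith)]
        linarith
    choose ξ hξ using key
    have h0 := ht 0 (by positivity)
    have hab : 0 ≤ b - a := by linarith [h0.1, h0.2]
    have hD1 : ∀ s ∈ Icc a b, |D 1 s| ≤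
        samplingFactor ((b - a) / δ) m * (2 * ε / δ) + (b - a) ^ m * M := by
      refine ih (D := fun k => D (k + 1)) (t := ξ) hδ (fun k hk => hD (k + 1) (by omega)) hM ?_ ?_
        fun i hi => (hξ i hi).2.2
      · intro i hi
        have h := hξ i hi
        exact ⟨(ht (2 * i) (by omega)).1.trans h.1, h.2.1.trans (ht (2 * i + 1) (by omega)).2⟩
      · intro i hi
        have h := hξ i (by omega)
        have h' := hξ (i + 1) hi
        have hs := hsep (2 * i + 1) (by omega)
        rw [show 2 * i + 1 + 1 = 2 * (i + 1) by ring] at hs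
        linarith [h.2.1, h'.1]
    -- Integrating the derivative bound back from `t 0` costs a factor `b - a`; this gives the
    -- recursion of `samplingFactor`.
    have hmv := (convex_Icc a b).norm_image_sub_le_of_norm_hasDerivWithin_le
      (hD 0 (by omega)) hD1 h0 hs
    rw [Real.norm_eq_abs, Real.norm_eq_abs] at hmv
    have hlen : |s - t 0| ≤ b - a := by
      rw [abs_le]; constructor <;> linarith [hs.1, hs.2, h0.1, h0.2]
    have hnn := (abs_nonneg _).trans (hD1 s hs)
    calc |D 0 s| = |D 0 (t 0) + (D 0 s - D 0 (t 0))| := by congr 1; ring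
      _ ≤ |D 0 (t 0)| + |D 0 s - D 0 (t 0)| := abs_add_le _ _
      _ ≤ ε + (samplingFactor ((b - a) / δ) m * (2 * ε / δ) + (b - a) ^ m * M) * (b - a) :=
        add_le_add (hε 0 (by positivity)) (hmv.trans (mul_le_mul_of_nonneg_left hlen hnn))
      _ = samplingFactor ((b - a) / δ) (m + 1) * ε + (b - a) ^ (m + 1) * M := by
        simp only [samplingFactor]; ring

/-! ### From an interval to the cube -/

theorem uniqueDiffOn_cube (d : ℕ) : UniqueDiffOn ℝ (cube d) := by
  rw [cube, ← pi_univ_Icc]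
  exact UniqueDiffOn.univ_pi fun _ => uniqueDiffOn_Icc zero_lt_one

theorem ext_coe {d : ℕ} (f : Cube d → ℝ) (x : Cube d) : ext f (x : Fin d → ℝ) = f x :=
  Subtype.val_injective.extend_apply _ _ _

theorem update_mem_cube {d : ℕ} {x : Fin d → ℝ} (hx : x ∈ cube d) (j : Fin d) {s : ℝ}
    (hs : s ∈ Icc (0 : ℝ) 1) : Function.update x j s ∈ cube d := by
  rw [cube, ← pi_univ_Icc] at hx ⊢
  intro i _
  rcases eq_or_ne i j with rfl | h
  · simpa using hs
  · simpa [h] using hx i trivial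

/-- Chain rule along a line parallel to an axis; it supplies the successive derivatives `D k` of the
one-dimensional estimate. -/
theorem hasDerivWithinAt_iteratedFDerivWithin_update {d m : ℕ} {F : (Fin d → ℝ) → ℝ}
    (hF : ContDiffOn ℝ m F (cube d)) {x : Fin d → ℝ} (hx : x ∈ cube d) (j : Fin d) {k : ℕ}
    (hk : k < m) {s : ℝ} (hs : s ∈ Icc (0 : ℝ) 1) :
    HasDerivWithinAt (fun s => iteratedFDerivWithin ℝ k F (cube d) (Function.update x j s)
        (fun _ => Pi.single j (1 : ℝ)))
      (iteratedFDerivWithin ℝ (k + 1) F (cube d) (Function.update x j s)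
        (fun _ => Pi.single j (1 : ℝ))) (Icc 0 1) s := by
  have h := (hF.ftaylorSeriesWithin (uniqueDiffOn_cube d)).fderivWithin k (by exact_mod_cast hk)
    _ (update_mem_cube hx j hs)
  have h2 := h.comp_hasDerivWithinAt s (hasDerivAt_update x j s).hasDerivWithinAt
    (t := cube d) (s := Icc 0 1) (fun s hs => update_mem_cube hx j hs)
  have h3 := (ContinuousMultilinearMap.apply ℝ (fun _ : Fin k => Fin d → ℝ) ℝ
    (fun _ => Pi.single j (1 : ℝ))).hasFDerivAt.comp_hasDerivWithinAt s h2
  have hcons : (fun _ => Pi.single j 1 : Fin (k + 1) → Fin d → ℝ) =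
      Fin.cons (Pi.single j 1) fun _ => Pi.single j 1 := by
    funext i
    refine Fin.cases ?_ (fun i => ?_) i <;> simp
  rw [hcons]
  exact h3

theorem abs_le_of_mem_smoothClass {d m : ℕ} {B : ℝ} {f : Cube d → ℝ}
    (hf : f ∈ smoothClass d m B) (x : Cube d) : |f x| ≤ B := by
  have h := hf.2 0 (Nat.zero_le _) Fin.elim0 x
  rwa [partialDeriv, iteratedFDerivWithin_zero_apply, ext_coe] at h

theorem continuous_of_mem_smoothClass {d m : ℕ} {B : ℝ} {f : Cube d → ℝ}
    (hf : f ∈ smoothClass d m B) : Continuous f := by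
  have h := continuousOn_iff_continuous_domRestrict.1 hf.1.continuousOn
  convert h using 1
  funext x
  exact (ext_coe f x).symm

/-- If two functions of the class differ by at most `ε` at all points that are obtained from `x` by
moving its `j`-th coordinate to the grid `{i / (q 2^m)}`, they differ by a controlled amount at
`x`. -/
theorem abs_sub_le_of_abs_sub_le_update {d m q : ℕ} (hq : 0 < q) {B : ℝ} {f g : Cube d → ℝ}
    (hf : f ∈ smoothClass d m B) (hg : g ∈ smoothClass d m B) (x : Cube d) (j : Fin d) {ε : ℝ}
    (hε : ∀ y : Cube d, (∃ i < q * 2 ^ m, y.1 j = (i : ℝ) / (q * 2 ^ m : ℕ)) →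
      (∀ i, i ≠ j → y.1 i = x.1 i) → |f y - g y| ≤ ε) :
    |f x - g x| ≤ samplingFactor (2 ^ m) m * ε + 2 * B / q ^ m := by
  have hqR : (0 : ℝ) < q := by exact_mod_cast hq
  have h2m : (0 : ℝ) < 2 ^ m := by positivity
  have hxj : x.1 j ∈ Icc (0 : ℝ) 1 := ⟨x.2.1 j, x.2.2 j⟩
  obtain ⟨p, hpq, hp1, hp2⟩ : ∃ p : ℕ, p < q ∧ (p : ℝ) / q ≤ x.1 j ∧ x.1 j ≤ (p + 1) / q := by
    -- The endpoint `1` is put into the last cell, since the floor would give the nonexistent cell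
    -- `q`.
    rcases eq_or_lt_of_le hxj.2 with h1 | h1
    · refine ⟨q - 1, by omega, ?_, ?_⟩
      · rw [h1, div_le_one hqR]
        exact_mod_cast Nat.sub_le _ _
      · rw [h1, Nat.cast_sub hq]
        simp [hqR.ne']
    · have h0 : 0 ≤ x.1 j * q := mul_nonneg hxj.1 hqR.le
      refine ⟨⌊x.1 j * q⌋₊, ?_, ?_, ?_⟩
      · rw [Nat.floor_lt h0]
        nlinarith
      · rw [div_le_iff₀ hqR]
        exact Nat.floor_le h0
      · rw [le_div_iff₀ hqR]
        exact (Nat.lt_floor_add_one _).le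
  set a : ℝ := (p : ℝ) / q with ha
  set b : ℝ := ((p : ℝ) + 1) / q with hb
  have hba : b - a = 1 / q := by rw [ha, hb]; ring
  have ha0 : 0 ≤ a := by positivity
  have hb1 : b ≤ 1 := by
    rw [hb, div_le_one hqR]
    exact_mod_cast hpq
  have hsub : Icc a b ⊆ Icc 0 1 := Icc_subset_Icc ha0 hb1
  let P : (Cube d → ℝ) → ℕ → ℝ → ℝ := fun f k s =>
    iteratedFDerivWithin ℝ k (ext f) (cube d) (Function.update x.1 j s)
      (fun _ => Pi.single j (1 : ℝ))
  have hP0 : ∀ (f : Cube d → ℝ) (s : ℝ) (hs : s ∈ Icc (0 : ℝ) 1),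
      P f 0 s = f ⟨_, update_mem_cube x.2 j hs⟩ := by
    intro f s hs
    simp only [P, iteratedFDerivWithin_zero_apply]
    exact ext_coe f ⟨_, update_mem_cube x.2 j hs⟩
  -- The cell has length `1 / q` and contains `2 ^ m` grid points at spacing `1 / (q 2^m)`. The
  -- ratio `2 ^ m` does not depend on `q`, so refining the grid leaves the amplification factor
  -- unchanged.
  have hmain := abs_le_of_abs_le_separated m (D := fun k s => P f k s - P g k s)
    (t := fun i => ((p * 2 ^ m + i : ℕ) : ℝ) / (q * 2 ^ m : ℕ)) (a := a) (b := b)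
    (δ := 1 / (q * 2 ^ m)) (M := 2 * B) (ε := ε) (by positivity)
    (fun k hk s hs => ((hasDerivWithinAt_iteratedFDerivWithin_update hf.1 x.2 j hk
      (hsub hs)).sub (hasDerivWithinAt_iteratedFDerivWithin_update hg.1 x.2 j hk
      (hsub hs))).mono hsub)
    (fun s hs => by
      have h1 := hf.2 m le_rfl (fun _ => j) ⟨_, update_mem_cube x.2 j (hsub hs)⟩
      have h2 := hg.2 m le_rfl (fun _ => j) ⟨_, update_mem_cube x.2 j (hsub hs)⟩
      exact (abs_sub _ _).trans (by rw [two_mul]; exact add_le_add h1 h2))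
  have ht : ∀ i < 2 ^ m, ((p * 2 ^ m + i : ℕ) : ℝ) / (q * 2 ^ m : ℕ) ∈ Icc a b := by
    intro i hi
    have hi' : (i : ℝ) ≤ 2 ^ m := by exact_mod_cast hi.le
    push_cast
    constructor
    · rw [ha, div_le_div_iff₀ hqR (by positivity)]
      nlinarith [mul_nonneg hqR.le (Nat.cast_nonneg (α := ℝ) i)]
    · rw [hb, div_le_div_iff₀ (by positivity) hqR]
      nlinarith
  have := hmain ht
    (fun i _ => le_of_eq (by push_cast; field_simp; ring))
    (fun i hi => by
      have hs := hsub (ht i hi)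
      simp only [hP0 _ _ hs]
      refine hε _ ⟨p * 2 ^ m + i, ?_, ?_⟩ ?_
      · nlinarith
      · simp
      · intro i hi
        simp [hi])
    (x.1 j) ⟨hp1, hp2⟩
  simp only [hP0 _ _ hxj, Function.update_eq_self, hba] at this
  refine this.trans (le_of_eq ?_)
  have hr : 1 / (q : ℝ) / (1 / (q * 2 ^ m)) = 2 ^ m := by field_simp
  rw [hr]
  ring

/-- The constant in the error bound for functions of `k` variables that agree on a grid. -/
def gridFactor (m : ℕ) : ℕ → ℝ
  | 0 => 0
  | k + 1 => samplingFactor (2 ^ m) m * gridFactor m k + 1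

theorem gridFactor_nonneg (m k : ℕ) : 0 ≤ gridFactor m k := by
  have hs : ∀ m' : ℕ, 0 ≤ samplingFactor (2 ^ m) m' := by
    intro m'
    induction m' with
    | zero => simp [samplingFactor]
    | succ m' ih => simp only [samplingFactor]; positivity
  induction k with
  | zero => simp [gridFactor]
  | succ k ih => have := hs m; simp only [gridFactor]; positivity

/-- The points of the cube all of whose coordinates lie in `{i / N : i < N}`. -/
def grid (d N : ℕ) : Set (Cube d) := {x | ∀ j, ∃ i < N, x.1 j = (i : ℝ) / N}

/-- Induction on the number `k` of coordinates allowed to leave the grid: moving coordinate `k` to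
the grid reduces to the case already bounded, at the cost of one use of the one-dimensional
estimate. -/
theorem abs_sub_le_of_eqOn_grid {d m q : ℕ} (hq : 0 < q) {B : ℝ} {f g : Cube d → ℝ}
    (hf : f ∈ smoothClass d m B) (hg : g ∈ smoothClass d m B)
    (hfg : EqOn f g (grid d (q * 2 ^ m))) (x : Cube d) :
    |f x - g x| ≤ gridFactor m d * (2 * B / q ^ m) := by
  have key : ∀ k ≤ d, ∀ x : Cube d,
      (∀ j : Fin d, k ≤ j → ∃ i < q * 2 ^ m, x.1 j = (i : ℝ) / (q * 2 ^ m : ℕ)) →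
      |f x - g x| ≤ gridFactor m k * (2 * B / q ^ m) := by
    intro k
    induction k with
    | zero =>
      intro _ x hx
      rw [hfg fun j => hx j (Nat.zero_le _)]
      simp [gridFactor]
    | succ k ih =>
      intro hk x hx
      refine (abs_sub_le_of_abs_sub_le_update hq hf hg x ⟨k, hk⟩
        (ε := gridFactor m k * (2 * B / q ^ m)) fun y hy hyx => ?_).trans (le_of_eq ?_)
      · refine ih (by omega) y fun j hj => ?_
        rcases eq_or_ne j ⟨k, hk⟩ with rfl | h
        · exact hy
        · rw [hyx j h]
          exact hx j (Nat.lt_of_le_of_ne hj fun h' => h (Fin.ext h'.symm))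
      · simp only [gridFactor]; ring
  exact key d le_rfl x fun j hj => absurd j.2 (by omega)

theorem grid_finite (d N : ℕ) : (grid d N).Finite ∧ (grid d N).ncard ≤ N ^ d := by
  let e : (Fin d → Fin N) → (Fin d → ℝ) := fun i j => ((i j : ℕ) : ℝ) / N
  have hsub : Subtype.val '' grid d N ⊆ range e := by
    rintro _ ⟨x, hx, rfl⟩
    choose i hi hx using hx
    exact ⟨fun j => ⟨i j, hi j⟩, funext fun j => (hx j).symm⟩
  have hfin : (range e).Finite := finite_range e
  refine ⟨(hfin.subset hsub).of_finite_image Subtype.val_injective.injOn, ?_⟩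
  rw [← ncard_image_of_injective _ Subtype.val_injective]
  refine (ncard_le_ncard hsub hfin).trans ?_
  rw [← image_univ]
  refine (ncard_image_le finite_univ).trans ?_
  simp [ncard_univ]

/-- The grid may have fewer than `⌊n/2⌋` points; the surplus evaluations are spent at a default
point. -/
theorem exists_subset_range_fin {α : Type*} [Inhabited α] {s : Set α} (hs : s.Finite) {N : ℕ}
    (hN : s.ncard ≤ N) : ∃ x : Fin N → α, s ⊆ range x := by
  have := hs.fintype
  rw [ncard_eq_toFinset_card', toFinset_card] at hN
  let e := (Fintype.equivFin s)
  refine ⟨fun i => if h : i.1 < Fintype.card s then (e.symm ⟨i, h⟩ : α) else default, ?_⟩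
  intro y hy
  refine ⟨⟨e ⟨y, hy⟩, (e ⟨y, hy⟩).2.trans_le hN⟩, ?_⟩
  simp only [Fin.is_lt, dite_true, Fin.eta, Equiv.symm_apply_apply]

/-! ### The upper envelope and its error -/

/-- The largest function on the cube that is consistent with the values `y` at the points `x` of a
function from the class. -/
def upperEnvelope {d N : ℕ} (F : Set (Cube d → ℝ)) (x : Fin N → Cube d) (y : Fin N → ℝ) :
    Cube d → ℝ := fun z => ⨆ f : {f : F // ∀ i, f.1 (x i) = y i}, f.1.1 z

section upperEnvelope

variable {d m N : ℕ} {B : ℝ} (x : Fin N → Cube d)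

/-- The real-valued supremum in `upperEnvelope` is meaningful only because the class is uniformly
bounded. -/
theorem bddAbove_consistent (y : Fin N → ℝ) (z : Cube d) : BddAbove (range
    fun f : {f : smoothClass d m B // ∀ i, f.1 (x i) = y i} => f.1.1 z) :=
  ⟨B, by rintro _ ⟨f, rfl⟩; exact (le_abs_self _).trans (abs_le_of_mem_smoothClass f.1.2 z)⟩

/-- The supremum may be uncountable, but a supremum of continuous functions is lower semicontinuous.
-/
theorem measurable_upperEnvelope (y : Fin N → ℝ) :
    Measurable (upperEnvelope (smoothClass d m B) x y) :=
  (lowerSemicontinuous_ciSup (bddAbove_consistent x y)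
    fun f => (continuous_of_mem_smoothClass f.1.2).lowerSemicontinuous).measurable

theorem le_upperEnvelope (f : smoothClass d m B) (z : Cube d) :
    f.1 z ≤ upperEnvelope (smoothClass d m B) x (fun i => f.1 (x i)) z :=
  le_ciSup (bddAbove_consistent x (fun i => f.1 (x i)) z) ⟨f, fun _ => rfl⟩

theorem upperEnvelope_le (f : smoothClass d m B) {ε : ℝ}
    (h : ∀ g : smoothClass d m B, (∀ i, g.1 (x i) = f.1 (x i)) → ∀ z, |g.1 z - f.1 z| ≤ ε)
    (z : Cube d) :
    upperEnvelope (smoothClass d m B) x (fun i => f.1 (x i)) z ≤ f.1 z + ε := by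
  have : Nonempty {g : smoothClass d m B // ∀ i, g.1 (x i) = f.1 (x i)} := ⟨⟨f, fun _ => rfl⟩⟩
  refine ciSup_le fun g => ?_
  linarith [le_abs_self (g.1.1 z - f.1 z), h g.1 g.2 z]

end upperEnvelope

/-- The constant in the error bound for upper envelopes. -/
def envelopeFactor (d m : ℕ) : ℝ := (2 * gridFactor m d + 2) * (2 ^ (m + 2)) ^ m

instance (d : ℕ) : Inhabited (Cube d) := ⟨⟨0, le_rfl, zero_le_one⟩⟩

theorem exists_upperEnvelope_le {d m n : ℕ} (hd : 1 ≤ d) (hn : 1 ≤ n) :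
    ∃ x : Fin (n / 2) → Cube d, ∀ B : ℝ, 0 < B → ∀ (f : smoothClass d m B) (z : Cube d),
      upperEnvelope (smoothClass d m B) x (fun i => f.1 (x i)) z ≤
        f.1 z + envelopeFactor d m * (B * (n : ℝ) ^ (-((m : ℝ) / (d : ℝ)))) := by
  have hnR : (0 : ℝ) < n := by exact_mod_cast hn
  -- `q` is the largest number of cells per axis whose grid fits into `⌊n/2⌋` points; maximality
  -- gives the second inequality, hence the rate.
  obtain ⟨q, hq1, hq2⟩ : ∃ q : ℕ, (q * 2 ^ m) ^ d ≤ n / 2 ∧ n ≤ ((q + 1) * 2 ^ (m + 1)) ^ d := by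
    have hex : ∃ q : ℕ, n / 2 < ((q + 1) * 2 ^ m) ^ d := by
      refine ⟨n / 2, ?_⟩
      calc n / 2 < n / 2 + 1 := Nat.lt_succ_self _
        _ ≤ (n / 2 + 1) * 2 ^ m := Nat.le_mul_of_pos_right _ (by positivity)
        _ ≤ ((n / 2 + 1) * 2 ^ m) ^ d := Nat.le_self_pow (by omega) _
    classical
    refine ⟨Nat.find hex, ?_, ?_⟩
    · rcases Nat.eq_zero_or_pos (Nat.find hex) with h | h
      · rw [h, zero_mul, zero_pow (by omega)]; exact Nat.zero_le _
      · have := Nat.find_min hex (m := Nat.find hex - 1) (by omega)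
        rw [Nat.sub_add_cancel h] at this
        exact not_lt.1 this
    · have := Nat.find_spec hex
      have h2 : 2 ≤ 2 ^ d := Nat.le_self_pow (by omega) 2
      calc n ≤ ((Nat.find hex + 1) * 2 ^ m) ^ d * 2 := by omega
        _ ≤ ((Nat.find hex + 1) * 2 ^ m) ^ d * 2 ^ d := Nat.mul_le_mul_left _ h2
        _ = ((Nat.find hex + 1) * 2 ^ (m + 1)) ^ d := by rw [← mul_pow]; ring
  have hrate : 1 ≤ ((q : ℝ) + 1) ^ m * ((2 ^ (m + 1)) ^ m * (n : ℝ) ^ (-((m : ℝ) / (d : ℝ)))) := by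
    have hdR : (d : ℝ) ≠ 0 := by positivity
    have h : (n : ℝ) ^ ((m : ℝ) / d) ≤ (((q : ℝ) + 1) * 2 ^ (m + 1)) ^ m := by
      calc (n : ℝ) ^ ((m : ℝ) / d)
          ≤ ((((q : ℝ) + 1) * 2 ^ (m + 1)) ^ d) ^ ((m : ℝ) / d) :=
            Real.rpow_le_rpow hnR.le (by exact_mod_cast hq2) (by positivity)
        _ = (((q : ℝ) + 1) * 2 ^ (m + 1)) ^ m := by
            rw [← Real.rpow_natCast, ← Real.rpow_mul (by positivity), mul_div_cancel₀ _ hdR,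
              Real.rpow_natCast]
    rw [← mul_assoc, ← mul_pow, Real.rpow_neg hnR.le, ← div_eq_mul_inv,
      le_div_iff₀ (Real.rpow_pos_of_pos hnR _), one_mul]
    exact h
  have hE := gridFactor_nonneg m d
  set ρ : ℝ := (2 ^ (m + 1)) ^ m * (n : ℝ) ^ (-((m : ℝ) / (d : ℝ))) with hρ
  have hρ0 : 0 < ρ := by positivity
  obtain ⟨hfin, hcard⟩ := grid_finite d (q * 2 ^ m)
  obtain ⟨x, hx⟩ := exists_subset_range_fin hfin (hcard.trans hq1)
  refine ⟨x, fun B hB f z => ?_⟩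
  refine upperEnvelope_le x f (fun g hg z => ?_) z
  have hgoal : envelopeFactor d m * (B * (n : ℝ) ^ (-((m : ℝ) / (d : ℝ)))) =
      (2 * gridFactor m d + 2) * B * (2 ^ m * ρ) := by
    rw [hρ, envelopeFactor, show (2 : ℝ) ^ (m + 2) = 2 * 2 ^ (m + 1) by ring, mul_pow]; ring
  rw [hgoal]
  -- If `q = 0` the budget is too small for one cell. The trivial bound `2B` suffices, which is why
  -- `envelopeFactor` contains `+ 2`.
  rcases Nat.eq_zero_or_pos q with h0 | hq
  · subst h0
    simp only [Nat.cast_zero, zero_add, one_pow, one_mul] at hrate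
    have h2 : (1 : ℝ) ≤ 2 ^ m * ρ :=
      one_le_mul_of_one_le_of_one_le (one_le_pow₀ one_le_two) hrate
    have h3 := (abs_sub (g.1 z) (f.1 z)).trans
      (add_le_add (abs_le_of_mem_smoothClass g.2 z) (abs_le_of_mem_smoothClass f.2 z))
    refine h3.trans ?_
    calc B + B = 2 * B * 1 := by ring
      _ ≤ (2 * gridFactor m d + 2) * B * (2 ^ m * ρ) :=
        mul_le_mul (mul_le_mul_of_nonneg_right (by linarith) hB.le) h2 zero_le_one
          (by positivity)
  · have hqR : (1 : ℝ) ≤ q := by exact_mod_cast hq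
    have h1 : 1 / (q : ℝ) ^ m ≤ 2 ^ m * ρ := by
      rw [div_le_iff₀ (by positivity)]
      calc (1 : ℝ) ≤ ((q : ℝ) + 1) ^ m * ρ := hrate
        _ ≤ (2 * q) ^ m * ρ := by gcongr; linarith
        _ = 2 ^ m * ρ * q ^ m := by rw [mul_pow]; ring
    have h2 := abs_sub_le_of_eqOn_grid hq g.2 f.2 (fun y hy => by
      obtain ⟨i, rfl⟩ := hx hy
      exact hg i) z
    calc |g.1 z - f.1 z| ≤ gridFactor m d * (2 * B / q ^ m) := h2
      _ = 2 * gridFactor m d * B * (1 / q ^ m) := by ring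
      _ ≤ (2 * gridFactor m d + 2) * B * (2 ^ m * ρ) :=
        mul_le_mul (mul_le_mul_of_nonneg_right (by linarith) hB.le) h1 (by positivity)
          (by positivity)

/-! ### Gibbs distributions and the law of rejection sampling -/

section gibbs

variable {d : ℕ} {f g : Cube d → ℝ} {b c : ℝ}

instance : IsProbabilityMeasure (volume : Measure (Cube d)) where
  measure_univ := by
    rw [Measure.Subtype.volume_univ measurableSet_Icc.nullMeasurableSet, Real.volume_Icc_pi]
    simp

theorem integrable_exp_of_abs_le (hf : Measurable f) (hb : ∀ x, |f x| ≤ b) :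
    Integrable (fun x => Real.exp (f x)) :=
  Integrable.of_bound (by fun_prop) (Real.exp b) (ae_of_all _ fun x => by
    rw [Real.norm_eq_abs, Real.abs_exp]
    exact Real.exp_le_exp.2 ((le_abs_self _).trans (hb x)))

theorem partitionFn_pos (hf : Measurable f) (hb : ∀ x, |f x| ≤ b) : 0 < partitionFn f :=
  integral_exp_pos (integrable_exp_of_abs_le hf hb)

theorem partitionFn_mono (hf : Measurable f) (hb : ∀ x, |f x| ≤ b) (hg : Measurable g)
    (hc : ∀ x, |g x| ≤ c) (hfg : ∀ x, f x ≤ g x) : partitionFn f ≤ partitionFn g :=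
  integral_mono (integrable_exp_of_abs_le hf hb) (integrable_exp_of_abs_le hg hc)
    fun x => Real.exp_le_exp.2 (hfg x)

theorem partitionFn_le_exp_mul (hf : Measurable f) (hb : ∀ x, |f x| ≤ b) (hg : Measurable g)
    (hc : ∀ x, |g x| ≤ c) {δ : ℝ} (hgf : ∀ x, g x ≤ f x + δ) :
    partitionFn g ≤ Real.exp δ * partitionFn f := by
  rw [partitionFn, partitionFn, ← integral_const_mul]
  refine integral_mono (integrable_exp_of_abs_le hg hc)
    ((integrable_exp_of_abs_le hf hb).const_mul _) fun x => ?_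
  rw [← Real.exp_add, add_comm]
  exact Real.exp_le_exp.2 (hgf x)

theorem isProbabilityMeasure_gibbs (hf : Measurable f) (hb : ∀ x, |f x| ≤ b) :
    IsProbabilityMeasure (gibbs f) where
  measure_univ := by
    have hZ := partitionFn_pos hf hb
    rw [gibbs, withDensity_apply _ .univ, Measure.restrict_univ,
      ← ofReal_integral_eq_lintegral_ofReal ((integrable_exp_of_abs_le hf hb).div_const _)
        (ae_of_all _ fun x => by positivity), integral_div, ← partitionFn, div_self hZ.ne',
      ENNReal.ofReal_one]

/-- For `f ≤ g` the weight `e^{f-g}` is the acceptance probability at a proposal. With `f` and `g`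
exchanged, the identity also gives the density of the mixture. -/
theorem withDensity_gibbs (hf : Measurable f) (hb : ∀ x, |f x| ≤ b) (hg : Measurable g)
    (hc : ∀ x, |g x| ≤ c) :
    (gibbs g).withDensity (fun x => ENNReal.ofReal (Real.exp (f x - g x))) =
      ENNReal.ofReal (partitionFn f / partitionFn g) • gibbs f := by
  have hZf := partitionFn_pos hf hb
  have hZg := partitionFn_pos hg hc
  rw [gibbs, gibbs, ← withDensity_mul _ (by fun_prop) (by fun_prop),
    ← withDensity_smul _ (by fun_prop)]
  congr 1
  funext x
  simp only [Pi.mul_apply, Pi.smul_apply, smul_eq_mul]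
  rw [← ENNReal.ofReal_mul (by positivity), ← ENNReal.ofReal_mul (by positivity), Real.exp_sub]
  congr 1
  have := (Real.exp_pos (g x)).ne'
  field_simp

theorem measurableSet_accept (hf : Measurable f) (hg : Measurable g) :
    MeasurableSet {p : Cube d × unitInterval |
      (p.2 : ℝ) * Real.exp (g p.1) ≤ Real.exp (f p.1)} :=
  measurableSet_le (by fun_prop) (by fun_prop)

open Classical in
/-- The result of one step of rejection sampling that falls back on `ν` upon rejection. -/
def rejectionStep (f g : Cube d → ℝ) (ν : Measure (Cube d)) (p : Cube d × unitInterval) :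
    Measure (Cube d) :=
  if (p.2 : ℝ) * Real.exp (g p.1) ≤ Real.exp (f p.1) then Measure.dirac p.1 else ν

theorem measurable_rejectionStep (hf : Measurable f) (hg : Measurable g)
    (ν : Measure (Cube d)) : Measurable (rejectionStep f g ν) :=
  Measurable.ite (measurableSet_accept hf hg)
    (Measure.measurable_dirac.comp measurable_fst) measurable_const

theorem rejectionLaw_succ (f g : Cube d → ℝ) (k : ℕ) : rejectionLaw f g (k + 1) =
    ((gibbs g).prod (volume : Measure unitInterval)).bind
      (rejectionStep f g (rejectionLaw f g k)) := rfl

theorem lintegral_ite_le {a : ℝ} (h0 : 0 ≤ a) (h1 : a ≤ 1) (y z : ℝ≥0∞) :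
    ∫⁻ u : unitInterval, (if (u : ℝ) ≤ a then y else z) =
      ENNReal.ofReal a * y + ENNReal.ofReal (1 - a) * z := by
  have hs : MeasurableSet (Iic (⟨a, h0, h1⟩ : unitInterval)) := measurableSet_Iic
  have : ∀ u : unitInterval, (if (u : ℝ) ≤ a then y else z) =
      (Iic (⟨a, h0, h1⟩ : unitInterval)).indicator (fun _ => y) u +
      (Iic (⟨a, h0, h1⟩ : unitInterval))ᶜ.indicator (fun _ => z) u := by
    intro u
    have hu : u ∈ Iic (⟨a, h0, h1⟩ : unitInterval) ↔ (u : ℝ) ≤ a := Iff.rfl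
    by_cases h : (u : ℝ) ≤ a <;> simp only [indicator, mem_compl_iff, hu, h] <;> simp
  simp only [this]
  rw [lintegral_add_left (measurable_const.indicator hs), lintegral_indicator_const hs,
    lintegral_indicator_const hs.compl, prob_compl_eq_one_sub hs, unitInterval.volume_Iic,
    mul_comm y, mul_comm z, ENNReal.ofReal_sub _ h0, ENNReal.ofReal_one]

/-- Integrating out the uniform variable leaves acceptance probability `e^{f-g} ≤ 1` at `x`. The
accepted part is then given by `withDensity_gibbs`, and the remaining mass restarts from `ν`
regardless of the rejected point. -/
theorem bind_rejectionStep (hf : Measurable f) (hb : ∀ x, |f x| ≤ b) (hg : Measurable g)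
    (hc : ∀ x, |g x| ≤ c) (hfg : ∀ x, f x ≤ g x) (ν : Measure (Cube d)) :
    ((gibbs g).prod (volume : Measure unitInterval)).bind (rejectionStep f g ν) =
      ENNReal.ofReal (partitionFn f / partitionFn g) • gibbs f +
        ENNReal.ofReal (1 - partitionFn f / partitionFn g) • ν := by
  have hPf := isProbabilityMeasure_gibbs hf hb
  have hPg := isProbabilityMeasure_gibbs hg hc
  have hZ0 : 0 ≤ partitionFn f / partitionFn g :=
    div_nonneg (partitionFn_pos hf hb).le (partitionFn_pos hg hc).le
  have hle : ∀ x, Real.exp (f x - g x) ≤ 1 := fun x => Real.exp_le_one_iff.2 (sub_nonpos.2 (hfg x))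
  have hacc : ∀ s, MeasurableSet s → ∫⁻ x, ENNReal.ofReal (Real.exp (f x - g x)) *
      s.indicator 1 x ∂gibbs g = ENNReal.ofReal (partitionFn f / partitionFn g) * gibbs f s := by
    intro s hs
    rw [← smul_eq_mul, ← Measure.smul_apply, ← withDensity_gibbs hf hb hg hc,
      withDensity_apply _ hs, ← lintegral_indicator hs]
    refine lintegral_congr fun x => ?_
    by_cases hx : x ∈ s <;> simp [hx]
  have hrej : ∫⁻ x, ENNReal.ofReal (1 - Real.exp (f x - g x)) ∂gibbs g =
      ENNReal.ofReal (1 - partitionFn f / partitionFn g) := by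
    have h1 := hacc univ .univ
    simp only [indicator_univ, Pi.one_apply, mul_one, measure_univ] at h1
    have h2 : ∫⁻ x, ENNReal.ofReal (Real.exp (f x - g x)) +
        ENNReal.ofReal (1 - Real.exp (f x - g x)) ∂gibbs g = 1 := by
      rw [← measure_univ (μ := gibbs g), ← lintegral_one]
      refine lintegral_congr fun x => ?_
      rw [← ENNReal.ofReal_add (Real.exp_pos _).le (sub_nonneg.2 (hle x)), add_sub_cancel,
        ENNReal.ofReal_one]
    rw [lintegral_add_left (by fun_prop), h1] at h2
    rw [ENNReal.ofReal_sub _ hZ0, ENNReal.ofReal_one, ← h2,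
      ENNReal.add_sub_cancel_left ENNReal.ofReal_ne_top]
  ext s hs
  have hmeas := measurable_rejectionStep hf hg ν
  rw [Measure.bind_apply hs hmeas.aemeasurable,
    lintegral_prod (fun p => rejectionStep f g ν p s)
      ((Measure.measurable_coe hs).comp hmeas).aemeasurable]
  have hinner : ∀ x, ∫⁻ u : unitInterval, rejectionStep f g ν (x, u) s =
      ENNReal.ofReal (Real.exp (f x - g x)) * s.indicator 1 x +
        ENNReal.ofReal (1 - Real.exp (f x - g x)) * ν s := by
    intro x
    rw [← lintegral_ite_le (Real.exp_pos _).le (hle x)]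
    refine lintegral_congr fun u => ?_
    have : (u : ℝ) * Real.exp (g x) ≤ Real.exp (f x) ↔ (u : ℝ) ≤ Real.exp (f x - g x) := by
      rw [Real.exp_sub, le_div_iff₀ (Real.exp_pos _)]
    by_cases h : (u : ℝ) ≤ Real.exp (f x - g x) <;>
      simp [rejectionStep, this, h, Measure.dirac_apply' _ hs]
  have hm : Measurable fun x => ENNReal.ofReal (Real.exp (f x - g x)) *
      s.indicator (1 : Cube d → ℝ≥0∞) x :=
    Measurable.mul (by fun_prop) (measurable_one.indicator hs)
  simp only [hinner]
  rw [lintegral_add_left hm, hacc s hs,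
    lintegral_mul_const _ (by fun_prop), hrej]
  simp

theorem rejectionLaw_eq (hf : Measurable f) (hb : ∀ x, |f x| ≤ b) (hg : Measurable g)
    (hc : ∀ x, |g x| ≤ c) (hfg : ∀ x, f x ≤ g x) (k : ℕ) :
    rejectionLaw f g k = ENNReal.ofReal (1 - rejectionProb f g k) • gibbs f +
      ENNReal.ofReal (rejectionProb f g k) • gibbs g := by
  have hZf := partitionFn_pos hf hb
  have hZg := partitionFn_pos hg hc
  have h0 : 0 ≤ partitionFn f / partitionFn g := by positivity
  have h1 : partitionFn f / partitionFn g ≤ 1 :=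
    (div_le_one hZg).2 (partitionFn_mono hf hb hg hc hfg)
  have h2 : 0 ≤ 1 - partitionFn f / partitionFn g := by linarith
  induction k with
  | zero => simp [rejectionLaw, rejectionProb]
  | succ k ih =>
    have h3 : (1 - partitionFn f / partitionFn g) ^ k ≤ 1 := pow_le_one₀ h2 (by linarith)
    rw [rejectionLaw_succ, bind_rejectionStep hf hb hg hc hfg, ih, smul_add, ← add_assoc,
      smul_smul, smul_smul, ← add_smul, rejectionProb, rejectionProb,
      ← ENNReal.ofReal_mul h2, ← ENNReal.ofReal_mul h2,
      ← ENNReal.ofReal_add h0 (mul_nonneg h2 (by linarith))]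
    congr 3 <;> ring

end gibbs

/-! ### Rejection sampling as an algorithm with a fixed random source -/

open Classical in
/-- The first of the values `x 0, …, x (k - 1)` that is accepted, and `x k` if all are rejected. -/
def firstAccepted {α : Type*} : (k : ℕ) → (Fin k → Prop) → (Fin (k + 1) → α) → α
  | 0, _, x => x 0
  | k + 1, acc, x => if acc 0 then x 0 else firstAccepted k (fun i => acc i.succ) fun i => x i.succ

/-- The result of rejection sampling as a function of the proposals and the uniform variables. -/
def rejectionSample {d : ℕ} (f g : Cube d → ℝ) (k : ℕ)
    (w : Fin (k + 1) → Cube d × unitInterval) : Cube d :=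
  firstAccepted k (fun i => ((w i.castSucc).2 : ℝ) * Real.exp (g (w i.castSucc).1) ≤
    Real.exp (f (w i.castSucc).1)) fun i => (w i).1

open Classical in
theorem rejectionSample_succ {d : ℕ} (f g : Cube d → ℝ) (k : ℕ)
    (w : Fin (k + 2) → Cube d × unitInterval) :
    rejectionSample f g (k + 1) w =
      if ((w 0).2 : ℝ) * Real.exp (g (w 0).1) ≤ Real.exp (f (w 0).1) then (w 0).1
      else rejectionSample f g k fun i => w i.succ := rfl

theorem measurable_rejectionSample {d : ℕ} {f g : Cube d → ℝ} (hf : Measurable f)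
    (hg : Measurable g) (k : ℕ) : Measurable (rejectionSample f g k) := by
  classical
  induction k with
  | zero => exact measurable_fst.comp (measurable_pi_apply 0)
  | succ k ih =>
    have : rejectionSample f g (k + 1) = fun w =>
      if ((w 0).2 : ℝ) * Real.exp (g (w 0).1) ≤ Real.exp (f (w 0).1) then (w 0).1
      else rejectionSample f g k fun i => w i.succ := funext (rejectionSample_succ f g k)
    rw [this]
    refine Measurable.ite ?_ (measurable_fst.comp (measurable_pi_apply 0)) (ih.comp ?_)
    · exact (measurableSet_accept hf hg).preimage (measurable_pi_apply 0)
    · exact measurable_pi_lambda _ fun i => measurable_pi_apply i.succ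

/-- Splitting off the first of `k + 1` independent pairs matches the recursion of `rejectionLaw`.
The last pair only supplies the fallback sample; its uniform variable is ignored. -/
theorem map_rejectionSample {d : ℕ} {f g : Cube d → ℝ} (hf : Measurable f)
    (hg : Measurable g) [IsProbabilityMeasure (gibbs g)] (k : ℕ) :
    (Measure.pi fun _ : Fin (k + 1) => (gibbs g).prod (volume : Measure unitInterval)).map
      (rejectionSample f g k) = rejectionLaw f g k := by
  classical
  set μ := (gibbs g).prod (volume : Measure unitInterval) with hμ
  induction k with
  | zero =>
    have h1 := (measurePreserving_eval (fun _ : Fin (0 + 1) => μ) 0).map_eq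
    have hcomp : rejectionSample f g 0 = Prod.fst ∘
        Function.eval (β := fun _ : Fin (0 + 1) => Cube d × unitInterval) 0 := rfl
    rw [hcomp, ← Measure.map_map measurable_fst (measurable_pi_apply 0), h1, hμ,
      Measure.map_fst_prod, measure_univ, one_smul, rejectionLaw]
  | succ k ih =>
    have hR := measurable_rejectionSample hf hg k
    have hstep := measurable_rejectionStep hf hg (rejectionLaw f g k)
    let R : (Cube d × unitInterval) × (Fin (k + 1) → Cube d × unitInterval) → Cube d := fun w =>
      if (w.1.2 : ℝ) * Real.exp (g w.1.1) ≤ Real.exp (f w.1.1) then w.1.1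
      else rejectionSample f g k w.2
    have hRm : Measurable R := Measurable.ite
      ((measurableSet_accept hf hg).preimage measurable_fst) (by fun_prop) (by fun_prop)
    have hmp := measurePreserving_piFinSuccAbove (fun _ : Fin (k + 2) => μ) 0
    have hcomp : rejectionSample f g (k + 1) = R ∘
        MeasurableEquiv.piFinSuccAbove (fun _ : Fin (k + 2) => Cube d × unitInterval) 0 := rfl
    rw [hcomp, ← Measure.map_map hRm hmp.measurable, hmp.map_eq, rejectionLaw_succ]
    ext s hs
    rw [Measure.map_apply hRm hs, Measure.prod_apply (hRm hs),
      Measure.bind_apply hs hstep.aemeasurable]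
    refine lintegral_congr fun p => ?_
    by_cases h : (p.2 : ℝ) * Real.exp (g p.1) ≤ Real.exp (f p.1)
    · have : Prod.mk p ⁻¹' (R ⁻¹' s) = if p.1 ∈ s then univ else ∅ := by
        ext w
        by_cases hp : p.1 ∈ s <;> simp [R, h, hp]
      rw [this, rejectionStep, if_pos h, Measure.dirac_apply' _ hs]
      by_cases hp : p.1 ∈ s <;> simp [hp]
    · have : Prod.mk p ⁻¹' (R ⁻¹' s) = rejectionSample f g k ⁻¹' s := by
        ext w
        simp [R, h]
      rw [this, rejectionStep, if_neg h, ← ih, Measure.map_apply hR hs]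

theorem SamplingAlgorithm.observe_eq {d n : ℕ} {Ω : Type} (A : SamplingAlgorithm d n Ω)
    (f : Cube d → ℝ) (ω : Ω) (k : ℕ) :
    A.observe f ω k = fun i : Fin k => f (A.evalPoint f i ω) := by
  induction k with
  | zero => exact funext fun i => i.elim0
  | succ k ih =>
    rw [SamplingAlgorithm.observe]
    funext i
    refine Fin.lastCases ?_ (fun i => ?_) i
    · simp [SamplingAlgorithm.evalPoint]
    · simp [ih]

/-- The algorithm that evaluates the function at the points `x`, computes `g = φ y` from the
obtained values `y`, and performs `k` steps of rejection sampling with proposals `τ y v`, where `v`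
is uniformly distributed. -/
def rejectionAlgorithm {d N : ℕ} (k : ℕ) (x : Fin N → Cube d) (φ : (Fin N → ℝ) → Cube d → ℝ)
    (τ : (Fin N → ℝ) → unitInterval → Cube d) :
    SamplingAlgorithm d (N + k) (Fin (k + 1) → unitInterval × unitInterval) where
  query j y ω :=
    if h : j < N then x ⟨j, h⟩
    -- Only queries with index below `N + k` are observed: the fallback proposal needs no evaluation
    -- of `f`. The bound `k + 1` merely matches the index type of `ω`.
    else if h' : j - N < k + 1 then τ (fun i => y ⟨i, i.2.trans_le (not_lt.1 h)⟩) (ω ⟨j - N, h'⟩).1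
    else default
  output y ω := firstAccepted k
    (fun i => ((ω i.castSucc).2 : ℝ) *
        Real.exp (φ (fun l => y (Fin.castAdd k l)) (τ (fun l => y (Fin.castAdd k l))
          (ω i.castSucc).1)) ≤ Real.exp (y (Fin.natAdd N i)))
    fun i => τ (fun l => y (Fin.castAdd k l)) (ω i).1

section rejectionAlgorithm

variable {d N : ℕ} (k : ℕ) (x : Fin N → Cube d) (φ : (Fin N → ℝ) → Cube d → ℝ)
  (τ : (Fin N → ℝ) → unitInterval → Cube d) (f : Cube d → ℝ)
  (ω : Fin (k + 1) → unitInterval × unitInterval)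

theorem rejectionAlgorithm_evalPoint_lt (j : Fin N) :
    (rejectionAlgorithm k x φ τ).evalPoint f j ω = x j := by
  simp [SamplingAlgorithm.evalPoint, rejectionAlgorithm]

theorem rejectionAlgorithm_evalPoint_add (j : Fin (k + 1)) :
    (rejectionAlgorithm k x φ τ).evalPoint f (N + j) ω = τ (fun i => f (x i)) (ω j).1 := by
  have hobs : ∀ i : Fin N, (rejectionAlgorithm k x φ τ).observe f ω (N + j)
      ⟨i, i.2.trans_le (Nat.le_add_right _ _)⟩ = f (x i) := by
    intro i
    rw [SamplingAlgorithm.observe_eq]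
    simp only [rejectionAlgorithm_evalPoint_lt]
  have hquery : ∀ y, (rejectionAlgorithm k x φ τ).query (N + j) y ω =
      τ (fun i => y ⟨i, i.2.trans_le (Nat.le_add_right _ _)⟩) (ω j).1 := by
    intro y
    have h : N + j - N < k + 1 := by omega
    have hj : (⟨N + j - N, h⟩ : Fin (k + 1)) = j := Fin.ext (by simp)
    simp only [rejectionAlgorithm]
    rw [dif_neg (by omega), dif_pos h, hj]
  rw [SamplingAlgorithm.evalPoint, hquery]
  simp only [hobs]

theorem rejectionAlgorithm_sample :
    (rejectionAlgorithm k x φ τ).sample f ω = rejectionSample f (φ fun i => f (x i)) k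
      fun i => (τ (fun i => f (x i)) (ω i).1, (ω i).2) := by
  have hobs : ∀ i : Fin N, (rejectionAlgorithm k x φ τ).observe f ω (N + k) (Fin.castAdd k i) =
      f (x i) := by
    intro i
    rw [SamplingAlgorithm.observe_eq]
    simp only [Fin.val_castAdd, rejectionAlgorithm_evalPoint_lt]
  have hobs' : ∀ i : Fin k, (rejectionAlgorithm k x φ τ).observe f ω (N + k) (Fin.natAdd N i) =
      f (τ (fun i => f (x i)) (ω i.castSucc).1) := by
    intro i
    rw [SamplingAlgorithm.observe_eq]
    simp only [Fin.val_natAdd]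
    exact congrArg f (rejectionAlgorithm_evalPoint_add k x φ τ f ω i.castSucc)
  change firstAccepted k _ _ = _
  simp only [hobs, hobs']
  rfl

end rejectionAlgorithm

/-- The cube is standard Borel, so every probability measure on it is the image of the uniform
distribution on `[0,1]` under a measurable map; this map may depend on the observed data `y`. -/
theorem exists_mem_adStochMaps {d N n k : ℕ} (hn : N + k = n) {F : Set (Cube d → ℝ)}
    (hF : ∀ f ∈ F, Measurable f) (x : Fin N → Cube d) (φ : (Fin N → ℝ) → Cube d → ℝ)
    (hφ : ∀ f ∈ F, Measurable (φ fun i => f (x i)))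
    (hφP : ∀ f ∈ F, IsProbabilityMeasure (gibbs (φ fun i => f (x i)))) :
    (fun f : F => rejectionLaw f.1 (φ fun i => f.1 (x i)) k) ∈ adStochMaps F n := by
  subst hn
  have : StandardBorelSpace (Cube d) := measurableSet_Icc.standardBorel
  have hτ : ∀ y : Fin N → ℝ, ∃ τ : unitInterval → Cube d,
      IsProbabilityMeasure (gibbs (φ y)) → MeasurePreserving τ volume (gibbs (φ y)) := by
    intro y
    by_cases h : IsProbabilityMeasure (gibbs (φ y))
    · obtain ⟨τ, h1, h2⟩ := Measure.exists_measurable_map_eq (gibbs (φ y))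
      exact ⟨τ, fun _ => ⟨h1, h2⟩⟩
    -- By `hφP`, such data `y` never arise from a function in `F`.
    · exact ⟨default, fun h' => absurd h' h⟩
  choose τ hτ using hτ
  refine ⟨Fin (k + 1) → unitInterval × unitInterval, inferInstance,
    Measure.pi fun _ => (volume : Measure unitInterval).prod volume,
    rejectionAlgorithm k x φ τ, inferInstance, fun f => ?_⟩
  have hP := hφP f f.2
  have hτf := hτ (fun i => f.1 (x i)) hP
  have hmp : MeasurePreserving
      (fun (ω : Fin (k + 1) → unitInterval × unitInterval) i =>
        (τ (fun i => f.1 (x i)) (ω i).1, (ω i).2))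
      (Measure.pi fun _ => (volume : Measure unitInterval).prod volume)
      (Measure.pi fun _ => (gibbs (φ fun i => f.1 (x i))).prod volume) :=
    measurePreserving_pi _ _ fun _ => hτf.prod (MeasurePreserving.id volume)
  have hsample : (rejectionAlgorithm k x φ τ).sample f.1 =
      rejectionSample f.1 (φ fun i => f.1 (x i)) k ∘
        fun ω i => (τ (fun i => f.1 (x i)) (ω i).1, (ω i).2) :=
    funext fun ω => rejectionAlgorithm_sample k x φ τ f.1 ω
  have hRm := measurable_rejectionSample (hF f f.2) (hφ f f.2) k
  refine ⟨fun j hj => ?_, hsample ▸ hRm.comp hmp.measurable, ?_⟩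
  · rcases lt_or_ge j N with h | h
    · have : (rejectionAlgorithm k x φ τ).evalPoint f.1 j = fun _ => x ⟨j, h⟩ :=
        funext fun ω => rejectionAlgorithm_evalPoint_lt k x φ τ f.1 ω ⟨j, h⟩
      rw [this]
      exact measurable_const
    · obtain ⟨i, rfl⟩ := Nat.exists_eq_add_of_le h
      have : (rejectionAlgorithm k x φ τ).evalPoint f.1 (N + i) =
          fun ω => τ (fun i => f.1 (x i)) (ω ⟨i, by omega⟩).1 :=
        funext fun ω => rejectionAlgorithm_evalPoint_add k x φ τ f.1 ω ⟨i, by omega⟩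
      rw [this]
      exact hτf.measurable.comp (measurable_fst.comp (measurable_pi_apply _))
  · rw [hsample, ← Measure.map_map hRm hmp.measurable, hmp.map_eq,
      map_rejectionSample (hF f f.2) (hφ f f.2)]

/-! ### Sup-log distance between `P_f` and the mixture -/

section supLogDist

variable {d : ℕ} {f g : Cube d → ℝ} {b c : ℝ}

/-- The density known here is `dQ/dP = w`; inverting it only changes the sign of the logarithm, and
`w > 0` gives mutual absolute continuity. -/
theorem supLogDist_withDensity_le {P Q : Measure (Cube d)} [SigmaFinite P] {w : Cube d → ℝ}
    (hw : Measurable w) (hpos : ∀ x, 0 < w x) {a : ℝ} (ha : ∀ x, |Real.log (w x)| ≤ a)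
    (hQ : Q = P.withDensity fun x => ENNReal.ofReal (w x)) :
    supLogDist P Q ≤ ENNReal.ofReal a := by
  have hwm : Measurable fun x => ENNReal.ofReal (w x) := by fun_prop
  have hQP : Q ≪ P := hQ ▸ withDensity_absolutelyContinuous _ _
  have hPQ : P ≪ Q := by
    rw [hQ]
    exact withDensity_absolutelyContinuous' hwm.aemeasurable
      (ae_of_all _ fun x => (ENNReal.ofReal_pos.2 (hpos x)).ne')
  have : SigmaFinite Q := by
    rw [hQ]
    exact SigmaFinite.withDensity_of_ne_top (ae_of_all _ fun x => ENNReal.ofReal_ne_top)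
  rw [supLogDist, if_pos ⟨hPQ, hQP⟩]
  refine (eLpNorm_le_of_ae_bound (C := a) ?_).trans (by simp)
  have h1 : Q.rnDeriv P =ᵐ[Q] fun x => ENNReal.ofReal (w x) := by
    rw [hQ]
    exact (withDensity_absolutelyContinuous _ _).ae_le (Measure.rnDeriv_withDensity P hwm)
  have h2 := Measure.inv_rnDeriv hQP
  filter_upwards [h1, h2] with x hx1 hx2
  rw [Pi.inv_apply] at hx2
  rw [← hx2, hx1, ENNReal.toReal_inv, ENNReal.toReal_ofReal (hpos x).le, Real.log_inv, norm_neg]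
  exact ha x

/-- The density of a mixture of two Gibbs distributions with respect to the first one. -/
theorem mixture_eq_withDensity (hf : Measurable f) (hb : ∀ x, |f x| ≤ b) (hg : Measurable g)
    (hc : ∀ x, |g x| ≤ c) {p : ℝ} (hp0 : 0 ≤ p) (hp1 : p ≤ 1) :
    ENNReal.ofReal (1 - p) • gibbs f + ENNReal.ofReal p • gibbs g =
      (gibbs f).withDensity fun x => ENNReal.ofReal
        (1 - p + p * (Real.exp (g x - f x) * (partitionFn f / partitionFn g))) := by
  have hZf := partitionFn_pos hf hb
  have hZg := partitionFn_pos hg hc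
  have h := withDensity_gibbs hg hc hf hb
  have hsplit : (fun x => ENNReal.ofReal
      (1 - p + p * (Real.exp (g x - f x) * (partitionFn f / partitionFn g)))) =
      (fun _ => ENNReal.ofReal (1 - p)) + ENNReal.ofReal (p * (partitionFn f / partitionFn g)) •
        fun x => ENNReal.ofReal (Real.exp (g x - f x)) := by
    funext x
    simp only [Pi.add_apply, Pi.smul_apply, smul_eq_mul]
    rw [← ENNReal.ofReal_mul (by positivity), ← ENNReal.ofReal_add (by linarith) (by positivity)]
    congr 1
    ring
  rw [hsplit, withDensity_add_left (by fun_prop), withDensity_const,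
    withDensity_smul _ (by fun_prop), h, smul_smul, ← ENNReal.ofReal_mul (by positivity)]
  congr 3
  field_simp

theorem abs_log_le_of_exp_le {δ y : ℝ} (h1 : Real.exp (-δ) ≤ y) (h2 : y ≤ Real.exp δ) :
    |Real.log y| ≤ δ := by
  have hy := (Real.exp_pos _).trans_le h1
  rw [abs_le]
  exact ⟨(Real.le_log_iff_exp_le hy).2 h1, (Real.log_le_iff_le_exp hy).2 h2⟩

/-- A convex combination of `1` and `q` stays in `[e^{-δ}, e^δ]`. -/
theorem abs_log_mixture_le {δ p q : ℝ} (hp0 : 0 ≤ p) (hp1 : p ≤ 1) (hδ0 : 0 ≤ δ)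
    (h1 : Real.exp (-δ) ≤ q) (h2 : q ≤ Real.exp δ) : |Real.log (1 - p + p * q)| ≤ δ := by
  have e1 : Real.exp (-δ) ≤ 1 := Real.exp_le_one_iff.2 (by linarith)
  have e2 : 1 ≤ Real.exp δ := Real.one_le_exp hδ0
  apply abs_log_le_of_exp_le <;> nlinarith

/-- The mixture lies between `1 - δp` and `1 + 2δp` and is at least `1/3`, so its logarithm lies
between `-3δp` and `2δp`; the factor `6` is not sharp. -/
theorem abs_log_mixture_le_mul {δ p q : ℝ} (hp0 : 0 ≤ p) (hp1 : p ≤ 1) (hδ0 : 0 ≤ δ)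
    (hδ1 : δ ≤ 1) (h1 : Real.exp (-δ) ≤ q) (h2 : q ≤ Real.exp δ) :
    |Real.log (1 - p + p * q)| ≤ 6 * (δ * p) := by
  have e1 : 1 - δ ≤ Real.exp (-δ) := by linarith [Real.add_one_le_exp (-δ)]
  have e2 : Real.exp δ ≤ 1 + 2 * δ := by
    have := Real.abs_exp_sub_one_le (x := δ) (by rwa [abs_of_nonneg hδ0])
    rw [abs_of_nonneg hδ0] at this
    linarith [(abs_le.1 this).2]
  have e3 : (1 : ℝ) / 3 ≤ Real.exp (-δ) := by
    have h3 : Real.exp (-1) ≤ Real.exp (-δ) := Real.exp_le_exp.2 (by linarith)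
    have h4 : (1 : ℝ) / 3 ≤ Real.exp (-1) := by
      rw [Real.exp_neg, one_div]
      exact inv_anti₀ (Real.exp_pos _) (by linarith [Real.exp_one_lt_d9])
    linarith
  set y := 1 - p + p * q with hy
  have hy3 : 1 / 3 ≤ y := by nlinarith
  have hy0 : 0 < y := by linarith
  have hyu : y ≤ 1 + 2 * (δ * p) := by nlinarith
  have hyl : 1 - δ * p ≤ y := by nlinarith
  have hδp : 0 ≤ δ * p := by positivity
  rw [abs_le]
  constructor
  · have := Real.one_sub_inv_le_log_of_pos hy0
    have h5 : y⁻¹ - 1 ≤ 3 * (δ * p) := by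
      rw [inv_eq_one_div, sub_le_iff_le_add, div_le_iff₀ hy0]
      nlinarith
    linarith
  · linarith [Real.log_le_sub_one_of_pos hy0]

/-- Of the `k + 1` factors `δ`, one comes from the log-density and `k` from the rejection
probability. `hδa` and `ha` handle the two regimes. -/
theorem supLogDist_mixture_le (hf : Measurable f) (hb : ∀ x, |f x| ≤ b) (hg : Measurable g)
    (hc : ∀ x, |g x| ≤ c) (hfg : ∀ x, f x ≤ g x) {δ : ℝ} (hgf : ∀ x, g x ≤ f x + δ)
    (k : ℕ) {a : ℝ} (hδa : 1 < δ → δ ≤ a) (ha : δ ≤ 1 → 6 * δ ^ (k + 1) ≤ a) :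
    supLogDist (gibbs f) (ENNReal.ofReal (1 - rejectionProb f g k) • gibbs f +
      ENNReal.ofReal (rejectionProb f g k) • gibbs g) ≤ ENNReal.ofReal a := by
  have hZf := partitionFn_pos hf hb
  have hZg := partitionFn_pos hg hc
  have hPf := isProbabilityMeasure_gibbs hf hb
  have hδ0 : 0 ≤ δ := by linarith [hfg default, hgf default]
  have hZ1 : partitionFn f / partitionFn g ≤ 1 :=
    (div_le_one hZg).2 (partitionFn_mono hf hb hg hc hfg)
  have hZδ : Real.exp (-δ) ≤ partitionFn f / partitionFn g := by
    rw [Real.exp_neg, inv_eq_one_div, div_le_div_iff₀ (Real.exp_pos _) hZg, one_mul, mul_comm]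
    exact partitionFn_le_exp_mul hf hb hg hc hgf
  have hr0 : 0 ≤ 1 - partitionFn f / partitionFn g := by linarith
  have hrδ : 1 - partitionFn f / partitionFn g ≤ δ := by linarith [Real.add_one_le_exp (-δ)]
  have hp0 : 0 ≤ rejectionProb f g k := pow_nonneg hr0 k
  have hp1 : rejectionProb f g k ≤ 1 :=
    pow_le_one₀ hr0 (by linarith [div_pos hZf hZg])
  have hpδ : rejectionProb f g k ≤ δ ^ k := pow_le_pow_left₀ hr0 hrδ k
  have hq1 : ∀ x, Real.exp (-δ) ≤ Real.exp (g x - f x) * (partitionFn f / partitionFn g) :=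
    fun x => hZδ.trans (le_mul_of_one_le_left (by positivity)
      (Real.one_le_exp (sub_nonneg.2 (hfg x))))
  have hq2 : ∀ x, Real.exp (g x - f x) * (partitionFn f / partitionFn g) ≤ Real.exp δ :=
    fun x => (mul_le_of_le_one_right (Real.exp_pos _).le hZ1).trans
      (Real.exp_le_exp.2 (by linarith [hgf x]))
  refine supLogDist_withDensity_le (by fun_prop) (fun x => ?_) (fun x => ?_)
    (mixture_eq_withDensity hf hb hg hc hp0 hp1)
  · have := (Real.exp_pos (-δ)).trans_le (hq1 x)
    rcases eq_or_lt_of_le hp0 with h | h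
    · rw [← h]; norm_num
    · have := mul_pos h this
      linarith
  · rcases lt_or_ge 1 δ with h | h
    · exact (abs_log_mixture_le hp0 hp1 hδ0 (hq1 x) (hq2 x)).trans (hδa h)
    · refine (abs_log_mixture_le_mul hp0 hp1 hδ0 h (hq1 x) (hq2 x)).trans (le_trans ?_ (ha h))
      rw [pow_succ']
      gcongr

end supLogDist

/-! ### Constants and conclusion -/

theorem envelopeFactor_pos (d m : ℕ) : 0 < envelopeFactor d m := by
  have := gridFactor_nonneg m d
  rw [envelopeFactor]
  positivity

theorem le_twoRegimeBound {C K r : ℝ} (hCK : C ≤ K) (hr : 0 ≤ r) {n : ℕ} (h : 1 < C * r) :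
    C * r ≤ twoRegimeBound C K r n := by
  rw [twoRegimeBound, if_pos h]
  gcongr

/-- The exponent `⌈n/2⌉ + 1` is at least `n/2 + 1`, and the base is at most `1`. -/
theorem mul_pow_le_twoRegimeBound {C K r : ℝ} (hK : 6 ≤ K) (hr : 0 < C * r) {n : ℕ}
    (h : C * r ≤ 1) : 6 * (C * r) ^ (n - n / 2 + 1) ≤ twoRegimeBound C K r n := by
  rw [twoRegimeBound, if_neg (not_lt.2 h), ← Real.rpow_natCast]
  have hn : (n : ℝ) / 2 + 1 ≤ ((n - n / 2 + 1 : ℕ) : ℝ) := by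
    have h2 : (n : ℝ) ≤ 2 * (n - n / 2 : ℕ) := by
      exact_mod_cast (by omega : n ≤ 2 * (n - n / 2))
    push_cast [Nat.cast_add, Nat.cast_one] at h2 ⊢
    linarith
  exact mul_le_mul hK (Real.rpow_le_rpow_of_exponent_ge hr h hn) (by positivity) (by linarith)

end GibbsSampling

end

theorem mainTheorem4 (d m : ℕ) (hd : 1 ≤ d) (hm : 1 ≤ m) :
    ∃ C : ℝ, 0 < C ∧ ∃ K : ℝ, 0 < K ∧ ∀ B : ℝ, 0 < B → ∀ n : ℕ, 1 ≤ n →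
      -- the bound on the minimax optimal error
      GibbsSampling.adStochError (GibbsSampling.smoothClass d m B) GibbsSampling.gibbs
          GibbsSampling.supLogDist n
        ≤ ENNReal.ofReal
            (GibbsSampling.twoRegimeBound C K (B * (n : ℝ) ^ (-((m : ℝ) / (d : ℝ)))) n) ∧
      -- the bound is achieved by approximation from `⌊n/2⌋` values, then `⌈n/2⌉` rejection steps
      ∃ S ∈ GibbsSampling.adStochMaps (GibbsSampling.smoothClass d m B) n,
      ∃ G ∈ GibbsSampling.detApproxMaps (GibbsSampling.smoothClass d m B) (n / 2),
        ∀ f : GibbsSampling.smoothClass d m B,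
          Measurable (G f) ∧
          (∀ x, f.1 x ≤ G f x ∧
            G f x ≤ f.1 x + C * (B * (n : ℝ) ^ (-((m : ℝ) / (d : ℝ))))) ∧
          S f = GibbsSampling.rejectionLaw f.1 (G f) (n - n / 2) ∧
          S f = ENNReal.ofReal (1 - GibbsSampling.rejectionProb f.1 (G f) (n - n / 2)) •
                GibbsSampling.gibbs f.1 +
              ENNReal.ofReal (GibbsSampling.rejectionProb f.1 (G f) (n - n / 2)) •
                GibbsSampling.gibbs (G f) ∧
          GibbsSampling.supLogDist (GibbsSampling.gibbs f.1) (S f)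
            ≤ ENNReal.ofReal
                (GibbsSampling.twoRegimeBound C K (B * (n : ℝ) ^ (-((m : ℝ) / (d : ℝ)))) n) :=
  by
  open GibbsSampling in
  have hC := envelopeFactor_pos d m
  -- In `K`, the entry `envelopeFactor d m` serves the regime `δ > 1`, and `6` the regime `δ ≤ 1`.
  refine ⟨envelopeFactor d m, hC, max (envelopeFactor d m) 6, lt_max_of_lt_left hC,
    fun B hB n hn => ?_⟩
  have hnR : (0 : ℝ) < n := by exact_mod_cast hn
  obtain ⟨x, hx⟩ := exists_upperEnvelope_le (m := m) hd hn
  have hr : 0 < B * (n : ℝ) ^ (-((m : ℝ) / (d : ℝ))) := by positivity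
  set r := B * (n : ℝ) ^ (-((m : ℝ) / (d : ℝ)))
  let φ := upperEnvelope (smoothClass d m B) x
  let G : smoothClass d m B → Cube d → ℝ := fun f => φ fun i => f.1 (x i)
  have hfm : ∀ f ∈ smoothClass d m B, Measurable f :=
    fun f hf => (continuous_of_mem_smoothClass hf).measurable
  have hfb : ∀ f : smoothClass d m B, ∀ z, |f.1 z| ≤ B := fun f => abs_le_of_mem_smoothClass f.2
  have hGm : ∀ f, Measurable (G f) := fun f => measurable_upperEnvelope x _
  have hfG : ∀ f : smoothClass d m B, ∀ z, f.1 z ≤ G f z := fun f => le_upperEnvelope x f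
  have hGf : ∀ f : smoothClass d m B, ∀ z, G f z ≤ f.1 z + envelopeFactor d m * r := hx B hB
  have hGb : ∀ f : smoothClass d m B, ∀ z, |G f z| ≤ B + envelopeFactor d m * r := by
    intro f z
    have := abs_le.1 (hfb f z)
    have := mul_pos hC hr
    rw [abs_le]
    constructor <;> linarith [hfG f z, hGf f z]
  have hlaw := fun f : smoothClass d m B => rejectionLaw_eq (hfm f.1 f.2) (hfb f) (hGm f) (hGb f)
    (hfG f) (n - n / 2)
  have hS : (fun f : smoothClass d m B => rejectionLaw f.1 (G f) (n - n / 2)) ∈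
      adStochMaps (smoothClass d m B) n :=
    exists_mem_adStochMaps (by omega) hfm x φ (fun f hf => hGm ⟨f, hf⟩)
      fun f hf => isProbabilityMeasure_gibbs (hGm ⟨f, hf⟩) (hGb ⟨f, hf⟩)
  have hdist : ∀ f : smoothClass d m B,
      supLogDist (gibbs f.1) (rejectionLaw f.1 (G f) (n - n / 2)) ≤
        ENNReal.ofReal (twoRegimeBound (envelopeFactor d m) (max (envelopeFactor d m) 6) r n) := by
    intro f
    rw [hlaw f]
    exact supLogDist_mixture_le (hfm f.1 f.2) (hfb f) (hGm f) (hGb f) (hfG f) (hGf f) _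
      (le_twoRegimeBound (le_max_left _ _) hr.le)
      (mul_pow_le_twoRegimeBound (le_max_right _ _) (mul_pos hC hr))
  exact ⟨(iInf₂_le _ hS).trans (iSup_le hdist), _, hS, G, ⟨x, φ, fun f => rfl⟩, fun f =>
    ⟨hGm f, fun z => ⟨hfG f z, hGf f z⟩, rfl, hlaw f, hdist f⟩⟩
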